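/- Let $K$ be an ordered field, let $V$ be an ordered vector space over $K$ (that is, a $K$-vector space with a linear order that makes it an ordered abelian group and for which $\lambda v>0$ whenever $\lambda>0$ in $K$ and $v>0$ in $V$), and let $W$ be a proper linear subspace of $V$ that is dense in $V$: for all $a<b$ in $V$ there is $w\in W$ with $a<w<b$. Fix a positive element of $W$, denoted $1$. Regard $(V,W)$ as a first-order structure in the language $\{+,-,0,1,<\}\cup\{\ell_\lambda:\lambda\in K\}\cup\{U\}$, where $\ell_\lambda$ is interpreted as scalar multiplication by $\lambda$ and the unary relation symbol $U$ as $W$. For a structure $\mathcal M$ with universe $M$ and a formula $\varphi(x;y)$ with object variables $x$ and parameter variables $y$, the shatter function is $$\pi_\varphi(k)=\max\bigl\{\,|\{A\cap\varphi(\mathcal M;b): b\in M^{|y|}\}| : A\subseteq M^{|x|},\ |A|=k\,\bigr\},$$ where $\varphi(\mathcal M;b)=\{a\in M^{|x|}:\mathcal M\models\varphi(a;b)\}$, and the VC-density of $\varphi$ in $\mathcal M$ is the infimum of the real numbers $r$ such that $\pi_\varphi(k)=O(k^r)$ as $k\to\infty$ (it is $+\infty$ if there is no such $r$). Then the VC-density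 in $(V,W)$ of the formula $$\varphi(x;y):\quad y\le x<y+1\ \vee\ U(x-y),$$ in which $x$ and $y$ are single variables, is exactly $2$. -/

import Mathlib

open FirstOrder Filter Asymptotics

/-! ### Shatter function and VC-density of a partitioned formula -/

section VC

variable {L : Language} {α β : Type*}

/-- For a partitioned formula `φ(x; y)` (object variables indexed by `α`, parameter variables
indexed by `β`) and `A ⊆ M^α`, the collection `A ∩ φ(M; y) = {A ∩ φ(M; b) : b ∈ M^β}`. -/
def traceFamily (M : Type*) [L.Structure M] (φ : L.Formula (α ⊕ β)) (A : Set (α → M)) :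
    Set (Set (α → M)) :=
  {S | ∃ b : β → M, S = A ∩ {a | φ.Realize (Sum.elim a b)}}

/-- The set of the numbers `|A ∩ φ(M; y)|`, where `A ⊆ M^α` has exactly `k` elements. -/
def traceCounts (M : Type*) [L.Structure M] (φ : L.Formula (α ⊕ β)) (k : ℕ) : Set ℕ :=
  {n | ∃ A : Finset (α → M), A.card = k ∧ n = (traceFamily M φ (A : Set (α → M))).ncard}

/-- The shatter function `π_φ(k) = max {|A ∩ φ(M; y)| : A ⊆ M^α, |A| = k}`. -/
noncomputable def shatterFunction (M : Type*) [L.Structure M] (φ : L.Formula (α ⊕ β))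
    (k : ℕ) : ℕ :=
  sSup (traceCounts M φ k)

theorem traceCounts_le (M : Type*) [L.Structure M] (φ : L.Formula (α ⊕ β)) (k n : ℕ)
    (hn : n ∈ traceCounts M φ k) : n ≤ 2 ^ k := by
  obtain ⟨A, rfl, rfl⟩ := hn
  rw [← Set.ncard_coe_finset A, ← Set.ncard_powerset _ A.finite_toSet]
  refine Set.ncard_le_ncard ?_ A.finite_toSet.powerset
  rintro S ⟨b, rfl⟩
  exact Set.inter_subset_left

/-- The supremum defining the shatter function is a maximum, as soon as `M^α` has a subset with
`k` elements. -/
theorem isGreatest_shatterFunction (M : Type*) [L.Structure M] (φ : L.Formula (α ⊕ β)) (k : ℕ)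
    (h : ∃ A : Finset (α → M), A.card = k) :
    IsGreatest (traceCounts M φ k) (shatterFunction M φ k) := by
  have hb : BddAbove (traceCounts M φ k) := ⟨2 ^ k, fun n hn => traceCounts_le M φ k n hn⟩
  obtain ⟨A, hA⟩ := h
  exact ⟨Nat.sSup_mem ⟨_, A, hA, rfl⟩ hb, fun n hn => le_csSup hb hn⟩

/-- The VC-density of `φ(x; y)` in `M`: the infimum of the real numbers `r` such that
`π_φ(k) = O(k ^ r)` as `k → ∞`. It is taken in the extended reals, so that it is `⊤` when there is
no such `r`. -/
noncomputable def vcDensity (M : Type*) [L.Structure M] (φ : L.Formula (α ⊕ β)) : EReal :=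
  sInf {d : EReal | ∃ r : ℝ, d = (r : EReal) ∧
    (fun k : ℕ => (shatterFunction M φ k : ℝ)) =O[atTop] (fun k : ℕ => (k : ℝ) ^ r)}

end VC

/-! ### The language of pairs of ordered vector spaces -/

/-- Function symbols: `0`, `1`, `-`, `ℓ_c` for `c ∈ K`, and `+`. -/
inductive OvsFunctions (K : Type*) : ℕ → Type _
  | zero : OvsFunctions K 0
  | one : OvsFunctions K 0
  | neg : OvsFunctions K 1
  | smul (c : K) : OvsFunctions K 1
  | add : OvsFunctions K 2

/-- Relation symbols: `<` and the unary predicate `U`. -/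
inductive OvsPairRelations : ℕ → Type
  | lt : OvsPairRelations 2
  | U : OvsPairRelations 1

/-- The language `{+, -, 0, 1, <} ∪ {ℓ_c : c ∈ K} ∪ {U}`. -/
def ovsPairLanguage (K : Type*) : Language :=
  ⟨OvsFunctions K, OvsPairRelations⟩

/-! ### Dense pairs of ordered vector spaces -/

section DensePair

variable {K V : Type*} [Field K] [LinearOrder K] [IsStrictOrderedRing K]
  [AddCommGroup V] [LinearOrder V] [IsOrderedAddMonoid V] [Module K V] [IsStrictOrderedModule K V]

/-- `(V, W)` is a dense pair of ordered vector spaces over `K`: `W` is a proper subspace of `V`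
that is dense for the order of `V`. -/
structure IsDensePair (W : Submodule K V) : Prop where
  proper : W ≠ ⊤
  dense : ∀ a b : V, a < b → ∃ w ∈ W, a < w ∧ w < b

/-- The underlying set `V` of the structure `(V, W)` in which the symbol `1` names `e`. -/
def OvsPair (_W : Submodule K V) (_e : V) : Type _ := V

/-- The interpretation in `V` of the function symbols, with `1` interpreted as `e`. -/
def ovsFunMap (e : V) : {n : ℕ} → OvsFunctions K n → (Fin n → V) → V
  | _, .zero, _ => 0
  | _, .one, _ => e
  | _, .neg, v => -v 0
  | _, .smul c, v => c • v 0
  | _, .add, v => v 0 + v 1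

/-- The interpretation in `V` of the relation symbols, with `U` interpreted as `W`. -/
def ovsPairRelMap (W : Submodule K V) : {n : ℕ} → OvsPairRelations n → (Fin n → V) → Prop
  | _, .lt, v => v 0 < v 1
  | _, .U, v => v 0 ∈ W

/-- The structure `(V, W)`. -/
instance OvsPair.instStructure (W : Submodule K V) (e : V) :
    (ovsPairLanguage K).Structure (OvsPair W e) where
  funMap := ovsFunMap e
  RelMap := ovsPairRelMap W

end DensePair

/-! ### The formula `y ≤ x < y + 1 ∨ U(x - y)` -/

section PairFormula

variable (K : Type*)

/-- The object variable `x`, as a term. -/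
def termX : (ovsPairLanguage K).Term (Fin 1 ⊕ Fin 1) := Language.Term.var (Sum.inl 0)

/-- The parameter variable `y`, as a term. -/
def termY : (ovsPairLanguage K).Term (Fin 1 ⊕ Fin 1) := Language.Term.var (Sum.inr 0)

variable {K}

/-- The atomic formula `s < t`. -/
def ltFormula {γ : Type*} (s t : (ovsPairLanguage K).Term γ) : (ovsPairLanguage K).Formula γ :=
  Language.Relations.formula₂ (L := ovsPairLanguage K) OvsPairRelations.lt s t

/-- The atomic formula `U(t)`. -/
def uFormula {γ : Type*} (t : (ovsPairLanguage K).Term γ) : (ovsPairLanguage K).Formula γ :=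
  Language.Relations.formula₁ (L := ovsPairLanguage K) OvsPairRelations.U t

/-- The term `s + t`. -/
def addTerm {γ : Type*} (s t : (ovsPairLanguage K).Term γ) : (ovsPairLanguage K).Term γ :=
  Language.Functions.apply₂ (L := ovsPairLanguage K) OvsFunctions.add s t

/-- The term `-t`. -/
def negTerm {γ : Type*} (t : (ovsPairLanguage K).Term γ) : (ovsPairLanguage K).Term γ :=
  Language.Functions.apply₁ (L := ovsPairLanguage K) OvsFunctions.neg t

/-- The constant term `1`. -/
def oneTerm {γ : Type*} : (ovsPairLanguage K).Term γ :=
  Language.Constants.term (L := ovsPairLanguage K) OvsFunctions.one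

variable (K)

/-- The partitioned formula `φ(x; y)`: `(y ≤ x ∧ x < y + 1) ∨ U(x - y)`, with `x` and `y` single
variables; `y ≤ x` is written as `y < x ∨ y = x`, and `x - y` as `x + (-y)`. -/
def intervalOrCosetFormula : (ovsPairLanguage K).Formula (Fin 1 ⊕ Fin 1) :=
  ((ltFormula (termY K) (termX K) ⊔ Language.Term.equal (termY K) (termX K)) ⊓
      ltFormula (termX K) (addTerm (termY K) oneTerm)) ⊔
    uFormula (addTerm (termX K) (negTerm (termY K)))

end PairFormula

/-! The trace of `φ(x; b)` on a set `A` of size `k` depends only on the cut of `b` in `A ∪ (A - e)`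
and on the coset `b + W`. There are at most `2k + 1` cuts and `k + 1` coset traces, so the shatter
function is `O(k²)`. Conversely, density makes the two choices independent
(`sq_le_shatterFunction`). Take `n` positive multiples of `e`, which lie in `W`, and `n` negative
points in distinct cosets other than `W`. A parameter `b` can be placed in any gap between
consecutive multiples of `e` and in any of these cosets; the interval then selects one multiple and
the coset one negative point, giving `n²` traces on `2n` points. -/

/-! ### Upper bound: cuts and cosets -/

theorem ncard_range_filter_lt_le {α : Type*} [LinearOrder α] (P : Finset α) :
    (Set.range fun b : α => P.filter (· < b)).ncard ≤ P.card + 1 := by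
  -- Initial segments of `P` form a chain, so cardinality separates them.
  have hinj : Set.InjOn Finset.card (Set.range fun b : α => P.filter (· < b)) := by
    rintro _ ⟨b, rfl⟩ _ ⟨c, rfl⟩ h
    rcases le_total b c with hbc | hbc
    · exact Finset.eq_of_subset_of_card_le
        (Finset.monotone_filter_right _ fun x _ hx => lt_of_lt_of_le hx hbc) h.ge
    · exact (Finset.eq_of_subset_of_card_le
        (Finset.monotone_filter_right _ fun x _ hx => lt_of_lt_of_le hx hbc) h.le).symm
  rw [← hinj.ncard_image]
  calc _ ≤ ((Finset.range (P.card + 1) : Finset ℕ) : Set ℕ).ncard := by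
        refine Set.ncard_le_ncard ?_ (Finset.finite_toSet _)
        rintro _ ⟨_, ⟨b, rfl⟩, rfl⟩
        simpa [Nat.lt_succ_iff] using Finset.card_filter_le P _
    _ = _ := by rw [Set.ncard_coe_finset, Finset.card_range]

/-- A nonempty trace is determined by any one of its points; the extra `1` counts the empty trace.
-/
theorem ncard_range_coset_trace_le {ι K V : Type*} [Field K] [AddCommGroup V] [Module K V]
    (W : Submodule K V) (A : Finset ι) (f : ι → V) :
    (Set.range fun b : V => {a | a ∈ A ∧ f a - b ∈ W}).ncard ≤ A.card + 1 := by
  classical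
  let G : ι → Set ι := fun c => {a | a ∈ A ∧ f a - f c ∈ W}
  calc _ ≤ ((insert ∅ (A.image G) : Finset (Set ι)) : Set (Set ι)).ncard := by
        refine Set.ncard_le_ncard ?_ (Finset.finite_toSet _)
        rintro _ ⟨b, rfl⟩
        by_cases h : ∃ c ∈ A, f c - b ∈ W
        · obtain ⟨c, hc, hcb⟩ := h
          refine Finset.mem_coe.2 (Finset.mem_insert_of_mem (Finset.mem_image.2 ⟨c, hc, ?_⟩))
          ext a
          refine and_congr_right fun _ => ?_
          rw [← W.add_mem_iff_left hcb, sub_add_sub_cancel]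
        · refine Finset.mem_coe.2 (Finset.mem_insert.2 (Or.inl ?_))
          push Not at h
          exact Set.eq_empty_of_forall_notMem fun a ha => h a ha.1 ha.2
    _ ≤ _ := by
        rw [Set.ncard_coe_finset]
        exact (Finset.card_insert_le _ _).trans (Nat.add_le_add_right Finset.card_image_le 1)

theorem IsDensePair.exists_sub_mem {K V : Type*} [Field K] [AddCommGroup V] [LinearOrder V]
    [IsOrderedAddMonoid V] [Module K V] {W : Submodule K V} (hW : IsDensePair W) (u : V) {a b : V}
    (hab : a < b) : ∃ c, c - u ∈ W ∧ a < c ∧ c < b := by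
  obtain ⟨w, hw, h₁, h₂⟩ := hW.dense (a - u) (b - u) (sub_lt_sub_right hab u)
  exact ⟨w + u, by simpa using hw, sub_lt_iff_lt_add.1 h₁, lt_sub_iff_add_lt.1 h₂⟩

theorem realize_intervalOrCosetFormula {K V : Type*} [Field K] [AddCommGroup V]
    [LinearOrder V] [Module K V] (W : Submodule K V) (e : V)
    (a b : Fin 1 → V) :
    (intervalOrCosetFormula K).Realize (M := OvsPair W e) (Sum.elim a b) ↔
      (b 0 ≤ a 0 ∧ a 0 < b 0 + e) ∨ a 0 - b 0 ∈ W := by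
  have hlt : ∀ s t : (ovsPairLanguage K).Term (Fin 1 ⊕ Fin 1),
      (ltFormula s t).Realize (M := OvsPair W e) (Sum.elim a b) ↔
        (show V from s.realize (M := OvsPair W e) (Sum.elim a b)) <
          (show V from t.realize (M := OvsPair W e) (Sum.elim a b)) := by
    intro s t
    exact Language.Formula.realize_rel₂
  have hU : ∀ t : (ovsPairLanguage K).Term (Fin 1 ⊕ Fin 1),
      (uFormula t).Realize (M := OvsPair W e) (Sum.elim a b) ↔
        (show V from t.realize (M := OvsPair W e) (Sum.elim a b)) ∈ W := by
    intro t
    exact Language.Formula.realize_rel₁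
  have hadd : ∀ s t : (ovsPairLanguage K).Term (Fin 1 ⊕ Fin 1),
      (addTerm s t).realize (M := OvsPair W e) (Sum.elim a b) =
        (show V from s.realize (M := OvsPair W e) (Sum.elim a b)) +
          (show V from t.realize (M := OvsPair W e) (Sum.elim a b)) := by
    intro s t
    exact Language.Term.realize_functions_apply₂
  have hneg : (negTerm (termY K)).realize (M := OvsPair W e) (Sum.elim a b) = (-b 0 : V) :=
    Language.Term.realize_functions_apply₁
  have hone : (oneTerm (K := K)).realize (M := OvsPair W e)
      (Sum.elim a b : Fin 1 ⊕ Fin 1 → OvsPair W e) = e :=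
    Language.Term.realize_constants
  have hX : (termX K).realize (M := OvsPair W e) (Sum.elim a b) = a 0 := rfl
  have hY : (termY K).realize (M := OvsPair W e) (Sum.elim a b) = b 0 := rfl
  rw [intervalOrCosetFormula, Language.Formula.realize_sup, Language.Formula.realize_inf,
    Language.Formula.realize_sup, Language.Formula.realize_equal, hlt, hlt, hU, hadd, hadd, hneg,
    hone, hX, hY, sub_eq_add_neg, le_iff_lt_or_eq]
  exact Iff.rfl

theorem ncard_traceFamily_le {K V : Type*} [Field K] [AddCommGroup V]
    [LinearOrder V] [IsOrderedAddMonoid V] [Module K V] (W : Submodule K V) (e : V) (A : Finset (Fin 1 → OvsPair W e)) :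
    (traceFamily (OvsPair W e) (intervalOrCosetFormula K) (A : Set (Fin 1 → OvsPair W e))).ncard ≤
      (2 * A.card + 1) * (A.card + 1) := by
  classical
  let f : (Fin 1 → OvsPair W e) → V := fun a => a 0
  let P : Finset V := A.image f ∪ A.image fun a => f a - e
  have hP : P.card ≤ 2 * A.card := by
    have h₁ : (A.image f).card ≤ A.card := Finset.card_image_le
    have h₂ : (A.image fun a => f a - e).card ≤ A.card := Finset.card_image_le
    exact (Finset.card_union_le _ _).trans (by omega)
  let S := Set.range fun b : V => P.filter (· < b)
  let T := Set.range fun b : V => {a | a ∈ A ∧ f a - b ∈ W}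
  have hS : S.Finite := P.powerset.finite_toSet.subset (by
    rintro _ ⟨b, rfl⟩
    exact Finset.mem_coe.2 (Finset.mem_powerset.2 (Finset.filter_subset _ _)))
  have hT : T.Finite := A.finite_toSet.powerset.subset (by
    rintro _ ⟨b, rfl⟩ a ha
    exact ha.1)
  -- `b ≤ x < b + e` says that `x` is not below `b` but `x - e` is, so the cut of `b` in `P` decides
  -- it.
  let F : Finset V × Set (Fin 1 → OvsPair W e) → Set (Fin 1 → OvsPair W e) :=
    fun q => {a | a ∈ A ∧ f a ∉ q.1 ∧ f a - e ∈ q.1} ∪ q.2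
  calc _ ≤ (F '' S ×ˢ T).ncard := by
        refine Set.ncard_le_ncard ?_ ((hS.prod hT).image F)
        rintro _ ⟨b, rfl⟩
        refine ⟨(_, _), ⟨⟨f b, rfl⟩, ⟨f b, rfl⟩⟩, ?_⟩
        ext a
        change _ ↔ a ∈ A ∧ _
        rw [Set.mem_ofPred_eq, realize_intervalOrCosetFormula W e a b, and_or_left]
        refine or_congr (and_congr_right fun ha => ?_) Iff.rfl
        have h₁ : f a ∈ P := Finset.mem_union_left _ (Finset.mem_image_of_mem _ ha)
        have h₂ : f a - e ∈ P :=
          Finset.mem_union_right _ (Finset.mem_image_of_mem (fun a => f a - e) ha)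
        change f a ∉ P.filter (· < f b) ∧ f a - e ∈ P.filter (· < f b) ↔ f b ≤ f a ∧ f a < f b + e
        rw [Finset.mem_filter, Finset.mem_filter, and_iff_right h₁, and_iff_right h₂, not_lt,
          sub_lt_iff_lt_add]
    _ ≤ (S ×ˢ T).ncard := Set.ncard_image_le (hS.prod hT)
    _ = S.ncard * T.ncard := Set.ncard_prod
    _ ≤ _ := Nat.mul_le_mul ((ncard_range_filter_lt_le P).trans (by omega))
        (ncard_range_coset_trace_le W A f)

theorem shatterFunction_le {K V : Type*} [Field K] [AddCommGroup V]
    [LinearOrder V] [IsOrderedAddMonoid V] [Module K V] (W : Submodule K V) (e : V) (k : ℕ) :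
    shatterFunction (OvsPair W e) (intervalOrCosetFormula K) k ≤ (2 * k + 1) * (k + 1) := by
  refine csSup_le' ?_
  rintro _ ⟨A, rfl, rfl⟩
  exact ncard_traceFamily_le W e A

/-! ### Lower bound: independent choice of gap and coset -/

theorem sq_le_shatterFunction {K V : Type*} [Field K] [LinearOrder K] [IsStrictOrderedRing K] [AddCommGroup V]
    [LinearOrder V] [IsOrderedAddMonoid V] [Module K V] (W : Submodule K V) (hW : IsDensePair W) (e : V) (heW : e ∈ W)
    (he : 0 < e) (n : ℕ) :
    n ^ 2 ≤ shatterFunction (OvsPair W e) (intervalOrCosetFormula K) (2 * n) := by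
  classical
  obtain ⟨v, hv⟩ : ∃ v, v ∉ W := by
    by_contra! h
    exact hW.proper (Submodule.eq_top_iff'.2 h)
  have hmul : ∀ c : K, c • v ∈ W → c = 0 := fun c hc => by
    by_contra h
    exact hv ((W.smul_mem_iff h).1 hc)
  -- The shift `j + 1` keeps every coset different from `W`, which contains all multiples of `e`.
  -- Only negativity of `q j` matters; `-e` is an arbitrary lower end.
  choose q hqW _ hq0 using fun j : ℕ =>
    hW.exists_sub_mem (((j : K) + 1) • v) (neg_neg_of_pos he)
  choose b hbW hb₁ hb₂ using fun i j : ℕ =>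
    hW.exists_sub_mem (((j : K) + 1) • v) (nsmul_lt_nsmul_left he (Nat.lt_succ_self i))
  have hpos : ∀ i : ℕ, 0 < (i + 1) • e := fun i => nsmul_pos he i.succ_ne_zero
  have hdiff : ∀ x y : V, ∀ j l : ℕ, x - ((j : K) + 1) • v ∈ W → y - ((l : K) + 1) • v ∈ W →
      x - y ∈ W → j = l := by
    intro x y j l hx hy hxy
    have h : ((j : K) - l) • v ∈ W := by
      have h' := W.add_mem (W.sub_mem hxy hx) hy
      convert h' using 1
      module
    exact_mod_cast sub_eq_zero.1 (hmul _ h)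
  have hqinj : Function.Injective q := fun j l h =>
    hdiff _ _ j l (hqW j) (hqW l) (by rw [h, sub_self]; exact W.zero_mem)
  have hpinj : Function.Injective fun i : ℕ => (i + 1) • e := fun i l h =>
    Nat.succ_injective (nsmul_left_strictMono he |>.injective h)
  let f : V → (Fin 1 → OvsPair W e) := fun x _ => x
  have hf : Function.Injective f := fun x y h => congrFun h 0
  let p : ℕ → V := fun i => (i + 1) • e
  let B : Finset V := (Finset.range n).image p ∪ (Finset.range n).image q
  have hB : B.card = 2 * n := by
    rw [Finset.card_union_of_disjoint, Finset.card_image_of_injective _ hpinj,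
      Finset.card_image_of_injective _ hqinj, Finset.card_range, two_mul]
    rw [Finset.disjoint_left]
    intro x hx hx'
    obtain ⟨i, _, rfl⟩ := Finset.mem_image.1 hx
    obtain ⟨j, _, hj⟩ := Finset.mem_image.1 hx'
    exact lt_asymm (hpos i) (hj.symm.trans_lt (hq0 j))
  let A : Finset (Fin 1 → OvsPair W e) := B.image f
  have hA : A.card = 2 * n := by rw [Finset.card_image_of_injective _ hf, hB]
  have hmem : (traceFamily (OvsPair W e) (intervalOrCosetFormula K)
      (A : Set (Fin 1 → OvsPair W e))).ncard ∈
        traceCounts (OvsPair W e) (intervalOrCosetFormula K) (2 * n) := ⟨A, hA, rfl⟩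
  refine le_trans ?_ ((isGreatest_shatterFunction _ _ _ ⟨A, hA⟩).2 hmem)
  have hp_mem : ∀ i j l : ℕ, (b i j ≤ p l ∧ p l < b i j + e) ∨ p l - b i j ∈ W ↔ l = i := by
    intro i j l
    constructor
    -- From `i • e < b i j < (i + 1) • e`, the first inequality gives `i ≤ l` and the second `l ≤
    -- i`.
    · rintro (⟨h₁, h₂⟩ | h)
      · have h₃ := (nsmul_lt_nsmul_iff_left he).1 ((hb₁ i j).trans_le h₁)
        have h₄ : (l + 1) • e < (i + 1 + 1) • e := by
          rw [succ_nsmul e (i + 1)]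
          exact h₂.trans (add_lt_add_left (hb₂ i j) e)
        have h₅ := (nsmul_lt_nsmul_iff_left he).1 h₄
        omega
      · have h' : ((j : K) + 1) • v ∈ W := by
          have h₁ := W.sub_mem (W.sub_mem (W.nsmul_mem heW (l + 1)) h) (hbW i j)
          convert h₁ using 1
          simp [p]
        have h₀ : ((j : K) + 1) ≠ 0 := by positivity
        exact absurd (hmul _ h') h₀
    · rintro rfl
      refine Or.inl ⟨(hb₂ l j).le, ?_⟩
      change (l + 1) • e < _
      rw [succ_nsmul]
      exact add_lt_add_left (hb₁ l j) e
  have hq_mem : ∀ i j l : ℕ, (b i j ≤ q l ∧ q l < b i j + e) ∨ q l - b i j ∈ W ↔ l = j := by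
    intro i j l
    constructor
    · rintro (⟨h₁, _⟩ | h)
      · exact absurd ((nsmul_nonneg he.le i).trans_lt ((hb₁ i j).trans_le h₁)) (hq0 l).not_gt
      · exact hdiff _ _ l j (hqW l) (hbW i j) h
    · rintro rfl
      refine Or.inr ?_
      have h := W.sub_mem (hqW l) (hbW i l)
      rwa [sub_sub_sub_cancel_right] at h
  let Φ : ℕ × ℕ → Set (Fin 1 → OvsPair W e) := fun ij =>
    (A : Set (Fin 1 → OvsPair W e)) ∩
      {a | (intervalOrCosetFormula K).Realize (Sum.elim a (f (b ij.1 ij.2)))}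
  have hΦp : ∀ (ij : ℕ × ℕ) (l : ℕ), l < n → (f (p l) ∈ Φ ij ↔ l = ij.1) := by
    intro ij l hl
    rw [← hp_mem ij.1 ij.2 l]
    refine Iff.trans (and_iff_right ?_) (realize_intervalOrCosetFormula W e _ _)
    exact Finset.mem_coe.2 (Finset.mem_image_of_mem f (Finset.mem_union_left _
      (Finset.mem_image_of_mem p (Finset.mem_range.2 hl))))
  have hΦq : ∀ (ij : ℕ × ℕ) (l : ℕ), l < n → (f (q l) ∈ Φ ij ↔ l = ij.2) := by
    intro ij l hl
    rw [← hq_mem ij.1 ij.2 l]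
    refine Iff.trans (and_iff_right ?_) (realize_intervalOrCosetFormula W e _ _)
    exact Finset.mem_coe.2 (Finset.mem_image_of_mem f (Finset.mem_union_right _
      (Finset.mem_image_of_mem q (Finset.mem_range.2 hl))))
  let R : Finset (ℕ × ℕ) := Finset.range n ×ˢ Finset.range n
  have hΦ : Set.InjOn Φ (R : Set (ℕ × ℕ)) := by
    intro x hx y _ hxy
    obtain ⟨h₁, h₂⟩ := Finset.mem_product.1 (Finset.mem_coe.1 hx)
    rw [Finset.mem_range] at h₁ h₂
    refine Prod.ext ((hΦp y _ h₁).1 ?_) ((hΦq y _ h₂).1 ?_)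
    · exact hxy ▸ (hΦp x _ h₁).2 rfl
    · exact hxy ▸ (hΦq x _ h₂).2 rfl
  calc n ^ 2 = (Φ '' (R : Set (ℕ × ℕ))).ncard := by
        rw [hΦ.ncard_image, Set.ncard_coe_finset, Finset.card_product,
          Finset.card_range, sq]
    _ ≤ _ := by
        refine Set.ncard_le_ncard ?_ (A.finite_toSet.powerset.subset ?_)
        · rintro _ ⟨ij, _, rfl⟩
          exact ⟨f (b ij.1 ij.2), rfl⟩
        · rintro _ ⟨c, rfl⟩
          exact Set.inter_subset_left

/-! ### Growth exponents -/

theorem isBigO_rpow_two_of_le {s : ℕ → ℕ} (hs : ∀ k, s k ≤ (2 * k + 1) * (k + 1)) :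
    (fun k : ℕ => (s k : ℝ)) =O[atTop] fun k : ℕ => (k : ℝ) ^ (2 : ℝ) := by
  -- For `k ≥ 1`, `(2k + 1)(k + 1) ≤ 3k · 2k`.
  refine IsBigO.of_bound 6 ?_
  filter_upwards [eventually_ge_atTop 1] with k hk
  have h₁ : (1 : ℝ) ≤ k := by exact_mod_cast hk
  have h₂ : (s k : ℝ) ≤ (2 * k + 1) * (k + 1) := by exact_mod_cast hs k
  rw [Real.rpow_two, Real.norm_of_nonneg (Nat.cast_nonneg _), Real.norm_of_nonneg (sq_nonneg _)]
  nlinarith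

/-- Even arguments suffice: if `r < 2`, then `n² ≤ s (2n) = O((2n)^r) = o(n²)`, which is absurd. -/
theorem two_le_of_isBigO_rpow {s : ℕ → ℕ} (hs : ∀ n, n ^ 2 ≤ s (2 * n)) {r : ℝ}
    (h : (fun k : ℕ => (s k : ℝ)) =O[atTop] fun k : ℕ => (k : ℝ) ^ r) : 2 ≤ r := by
  by_contra! hr
  have hdouble : Tendsto (fun n : ℕ => 2 * n) atTop atTop :=
    tendsto_id.const_mul_atTop' two_pos
  have h₁ : (fun n : ℕ => (n : ℝ) ^ (2 : ℝ)) =O[atTop] fun n : ℕ => (s (2 * n) : ℝ) := by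
    refine IsBigO.of_bound 1 (Eventually.of_forall fun n => ?_)
    rw [Real.rpow_two, Real.norm_of_nonneg (Nat.cast_nonneg _), Real.norm_of_nonneg (sq_nonneg _),
      one_mul]
    exact_mod_cast hs n
  have h₂ : (fun n : ℕ => ((2 * n : ℕ) : ℝ) ^ r) =O[atTop] fun n : ℕ => (n : ℝ) ^ r := by
    refine IsBigO.of_bound ‖(2 : ℝ) ^ r‖ (Eventually.of_forall fun n => le_of_eq ?_)
    rw [Nat.cast_mul, Nat.cast_ofNat, Real.mul_rpow two_pos.le (Nat.cast_nonneg n), norm_mul]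
  have h₃ : (fun n : ℕ => (n : ℝ) ^ r) =o[atTop] fun n : ℕ => (n : ℝ) ^ (2 : ℝ) := by
    refine (isLittleO_of_tendsto' ?_ ?_ :
      (fun x : ℝ => x ^ r) =o[atTop] fun x => x ^ (2 : ℝ)).comp_tendsto tendsto_natCast_atTop_atTop
    · filter_upwards [eventually_gt_atTop 0] with x hx h
      exact absurd h (Real.rpow_pos_of_pos hx _).ne'
    · refine (tendsto_rpow_neg_atTop (sub_pos.2 hr)).congr' ?_
      filter_upwards [eventually_gt_atTop 0] with x hx
      rw [neg_sub, Real.rpow_sub hx]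
  refine isLittleO_irrefl ?_ ((h₁.trans ((h.comp_tendsto hdouble).trans h₂)).trans_isLittleO h₃)
  refine ((eventually_ge_atTop 1).mono fun n hn => ?_).frequently
  have : (0 : ℝ) < n := by exact_mod_cast hn
  exact (Real.rpow_pos_of_pos this _).ne'

theorem mainTheorem4 {K V : Type*} [Field K] [LinearOrder K] [IsStrictOrderedRing K]
    [AddCommGroup V] [LinearOrder V] [IsOrderedAddMonoid V] [Module K V]
    [IsStrictOrderedModule K V]
    (W : Submodule K V) (hW : IsDensePair W) (e : V) (heW : e ∈ W) (he : 0 < e) :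
    vcDensity (OvsPair W e) (intervalOrCosetFormula K) = 2 := by
  refine le_antisymm (sInf_le ⟨2, rfl, isBigO_rpow_two_of_le (shatterFunction_le W e)⟩)
    (le_sInf ?_)
  rintro _ ⟨r, rfl, hr⟩
  exact EReal.coe_le_coe_iff.2 <| two_le_of_isBigO_rpow (sq_le_shatterFunction W hW e heW he) hr
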